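/- Let $\nu\ge 1$ be an integer. For $\delta\ge 0$ let $\chi^2_\nu(\delta)$ denote the noncentral chi-square distribution with $\nu$ degrees of freedom and noncentrality parameter $\delta$, i.e. the law of $Z_1^2+\dots+Z_\nu^2$ with independent $Z_1\sim N(\sqrt\delta,1)$ and $Z_2,\dots,Z_\nu\sim N(0,1)$, and let $H_{\nu,0}$ be the distribution function of $\chi^2_\nu(0)$. Let $\tfrac12<\beta<1$ and $0<r<1$, and put $$\rho(\beta)=\begin{cases}\beta-\tfrac12, & \tfrac12<\beta<\tfrac34,\\ (1-\sqrt{1-\beta})^2, & \tfrac34\le\beta<1,\end{cases}\qquad q(u)=\sqrt{u(1-u)\log\log\frac{1}{u(1-u)}}\quad(0<u<1).$$ For a sample $X_1,\dots,X_n$ let $S_i=1-H_{\nu,0}(X_i)$, let $\mathbb H_n(u)=n^{-1}\#\{i\le n: S_i\le u\}$, and let $$T_n^+(q)=\sup_{0<u<1}\frac{\sqrt n\,(\mathbb H_n(u)-u)}{q(u)}.$$ Let $0<\alpha<1$, and let $t^+_\alpha(q)\in\mathbb R$ be a critical value chosen such that $P\big(\sup_{0<u<1}B(u)/q(u)\ge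 t^+_\alpha(q)\big)=\alpha$, where $B$ is a Brownian bridge on $[0,1]$. Theorem 4.2. Suppose that, for each $n$, $X_1,\dots,X_n$ are independent and identically distributed with law $$(1-n^{-\beta})\,\chi^2_\nu(0)+n^{-\beta}\,\chi^2_\nu(2r\log n).$$ If $r>\rho(\beta)$, then the test that rejects when $T_n^+(q)\ge t^+_\alpha(q)$ has asymptotically full power: $$P\big(T_n^+(q)\ge t^+_\alpha(q)\big)\to 1\qquad(n\to\infty).$$ -/

import Mathlib

open MeasureTheory ProbabilityTheory Filter Topology

noncomputable section

namespace SparseMixture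

/-- The weight function `q(u) = √(u(1-u) log log (1/(u(1-u))))`, used for `0 < u < 1`,
where `1/(u(1-u)) ≥ 4 > e`, so that `q(u) > 0`. -/
def weight (u : ℝ) : ℝ :=
  Real.sqrt (u * (1 - u) * Real.log (Real.log (1 / (u * (1 - u)))))

/-- A Brownian bridge on `[0,1]`: a centred Gaussian process with covariance
`min s t - s t` and almost surely continuous paths. -/
structure IsBrownianBridge {Ω : Type*} [MeasurableSpace Ω]
    (B : Set.Icc (0 : ℝ) 1 → Ω → ℝ) (P : Measure Ω) : Prop where
  gaussian : IsGaussianProcess B P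
  mean : ∀ u, ∫ ω, B u ω ∂P = 0
  cov : ∀ s t, cov[B s, B t; P] = min (s : ℝ) (t : ℝ) - (s : ℝ) * (t : ℝ)
  continuous : ∀ᵐ ω ∂P, Continuous fun u => B u ω

/-- `sup_{0<u<1} b(u)/q(u)` for a function `b` on `[0,1]`, as an extended real number. -/
def weightedSup (b : Set.Icc (0 : ℝ) 1 → ℝ) : EReal :=
  ⨆ u : Set.Ioo (0 : ℝ) 1, ((b ⟨u, Set.Ioo_subset_Icc_self u.2⟩ / weight u : ℝ) : EReal)

/-- `t` is a critical value at level `α`: `P(sup_{0<u<1} B(u)/q(u) ≥ t) = α` for the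
Brownian bridge `B`. -/
def IsCriticalValue {Ω : Type*} [MeasurableSpace Ω]
    (B : Set.Icc (0 : ℝ) 1 → Ω → ℝ) (P : Measure Ω) (α t : ℝ) : Prop :=
  P.real {ω | (t : EReal) ≤ weightedSup fun u => B u ω} = α

/-- The empirical distribution function `u ↦ n⁻¹ #{i : s i ≤ u}` of a sample `s`. -/
def edf {n : ℕ} (s : Fin n → ℝ) (u : ℝ) : ℝ :=
  (∑ i, if s i ≤ u then (1 : ℝ) else 0) / n

/-- The noncentral chi-square distribution with `ν` degrees of freedom and noncentrality
parameter `δ ≥ 0`: the law of `Z₁² + ⋯ + Z_ν²` for independent `Z₁ ∼ N(√δ, 1)` and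
`Z₂, …, Z_ν ∼ N(0, 1)`. -/
def noncentralChiSq (ν : ℕ) (δ : ℝ) : Measure ℝ :=
  (Measure.pi fun i : Fin ν => gaussianReal (if i.val = 0 then Real.sqrt δ else 0) 1).map
    fun z => ∑ i, z i ^ 2

/-- The mixture `(1 - n^{-β}) χ²_ν(0) + n^{-β} χ²_ν(2 r log n)`. -/
def chiSqMixture (ν : ℕ) (β r : ℝ) (n : ℕ) : Measure ℝ :=
  ENNReal.ofReal (1 - (n : ℝ) ^ (-β)) • noncentralChiSq ν 0 +
    ENNReal.ofReal ((n : ℝ) ^ (-β)) • noncentralChiSq ν (2 * r * Real.log n)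

/-- The transformed observation `S = 1 - H_{ν,0}(X)`, where `H_{ν,0}` is the distribution
function of `χ²_ν(0)`. -/
def chiSqPValue (ν : ℕ) (x : ℝ) : ℝ :=
  1 - cdf (noncentralChiSq ν 0) x

/-- `T_n⁺(q) = sup_{0<u<1} √n (ℍ_n(u) - u)/q(u)`, as an extended real number, where `ℍ_n` is
the empirical distribution function of the transformed observations. -/
def testStat (ν : ℕ) {n : ℕ} (x : Fin n → ℝ) : EReal :=
  weightedSup fun u => Real.sqrt n * (edf (fun i => chiSqPValue ν (x i)) u - u)

/-- The detection boundary, for `1/2 < β < 1`. -/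
def detectionBoundary (β : ℝ) : ℝ :=
  if β < 3 / 4 then β - 1 / 2 else (1 - Real.sqrt (1 - β)) ^ 2

end SparseMixture

end

namespace SparseMixture

/-! A single point of the supremum suffices. Put `ε = n^(-β)`, `x = 2 s log n`, and let `u`, `v` be
the null and alternative probabilities of exceeding `x`. By `le_testStat` the test rejects once the
number of exceedances reaches `n u + t √n q(u)`. Its mean exceeds `n u` by `n ε (v - u)`, and
Chebyshev (`measureReal_count_le`) gives power tending to 1 if `n ε v` dominates `n ε u`, `√n q(u)`
and the standard deviation, at most `√(n (u + ε v))`. With `w = (√s - √r)²`, up to factors `n^η`,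
`u` is at most `n^(-s)`, `v` at least `n^(-w)` and `q(u)²` at most `n^(-s)`. What remains is `w <
s`, `1 - 2β - 2w + s > 0` and `1 - β - w > 0`; `exists_threshold_exponent` finds such an `s ≤ 1`
exactly from `r > ρ(β)`. -/

/-- Chebyshev's lower-tail bound for the number of points of an iid sample in a set. -/
theorem measureReal_count_le {Ω : Type*} [MeasurableSpace Ω] {P : Measure Ω}
    [IsProbabilityMeasure P] {n : ℕ} {X : Fin n → Ω → ℝ} (hindep : iIndepFun X P)
    {μ : Measure ℝ} (hlaw : ∀ i, HasLaw (X i) μ P) {A : Set ℝ} (hA : MeasurableSet A)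
    {d : ℝ} (hd : 0 < d) :
    P.real {ω | ∑ i, A.indicator (1 : ℝ → ℝ) (X i ω) ≤ n * μ.real A - d} ≤
      n * μ.real A / d ^ 2 := by
  have hAm : Measurable (A.indicator (1 : ℝ → ℝ)) := measurable_one.indicator hA
  set Y : Fin n → Ω → ℝ := fun i => A.indicator (1 : ℝ → ℝ) ∘ X i with hY
  have hYm : ∀ i, AEMeasurable (Y i) P := fun i => hAm.comp_aemeasurable (hlaw i).aemeasurable
  have hYb : ∀ i ω, ‖Y i ω‖ ≤ 1 := fun i ω => by
    by_cases h : X i ω ∈ A <;> simp [hY, h]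
  have hYL : ∀ i, MemLp (Y i) 2 P := fun i =>
    MemLp.of_bound (hYm i).aestronglyMeasurable 1 (Eventually.of_forall (hYb i))
  have hYE : ∀ i, ∫ ω, Y i ω ∂P = μ.real A := fun i => by
    rw [hY, (hlaw i).integral_comp hAm.aestronglyMeasurable, integral_indicator_one hA]
  have hYsq : ∀ i, Y i ^ 2 = Y i := fun i => by
    ext ω
    by_cases h : X i ω ∈ A <;> simp [hY, h]
  have hsumE : ∫ ω, (∑ i, Y i) ω ∂P = n * μ.real A := by
    simp only [Finset.sum_apply]
    rw [integral_finsetSum _ fun i _ => (hYL i).integrable (by norm_num)]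
    simp [hYE]
  have hvar : variance (∑ i, Y i) P ≤ n * μ.real A := by
    rw [IndepFun.variance_sum (fun i _ => hYL i)
      fun i _ j _ hij => (hindep.indepFun hij).comp hAm hAm]
    calc ∑ i, variance (Y i) P ≤ ∑ _i : Fin n, μ.real A := Finset.sum_le_sum fun i _ => by
          refine (variance_le_expectation_sq (hYm i).aestronglyMeasurable).trans_eq ?_
          rw [hYsq, hYE]
      _ = n * μ.real A := by simp
  have hcheb := meas_ge_le_variance_div_sq (memLp_finsetSum' Finset.univ fun i _ => hYL i) hd
  have hle : P {ω | ∑ i, A.indicator (1 : ℝ → ℝ) (X i ω) ≤ n * μ.real A - d} ≤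
      ENNReal.ofReal (n * μ.real A / d ^ 2) := by
    refine (measure_mono fun ω hω => ?_).trans (hcheb.trans (ENNReal.ofReal_le_ofReal ?_))
    · simp only [Set.mem_ofPred_eq] at hω ⊢
      rw [hsumE, Finset.sum_apply, abs_sub_comm]
      refine le_trans ?_ (le_abs_self _)
      simp only [hY, Function.comp_apply]
      linarith
    · gcongr
  exact ENNReal.toReal_le_of_le_ofReal (by positivity) hle

/-! ### Tails of chi-square laws -/

theorem measurable_sum_sq (ν : ℕ) : Measurable fun z : Fin ν → ℝ => ∑ i, z i ^ 2 := by
  fun_prop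

instance (ν : ℕ) (δ : ℝ) : IsProbabilityMeasure (noncentralChiSq ν δ) :=
  Measure.isProbabilityMeasure_map (measurable_sum_sq ν).aemeasurable

theorem integrable_exp_mul_sq_gaussianReal {l : ℝ} (hl : l < 1 / 2) :
    Integrable (fun z => Real.exp (l * z ^ 2)) (gaussianReal 0 1) := by
  rw [gaussianReal_of_var_ne_zero _ one_ne_zero,
    integrable_withDensity_iff (measurable_gaussianPDF _ _)
      (Eventually.of_forall fun _ => gaussianPDF_lt_top)]
  have h := (integrable_exp_neg_mul_sq (b := 1 / 2 - l) (by linarith)).mul_const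
    (√(2 * Real.pi * 1))⁻¹
  refine h.congr (Eventually.of_forall fun z => ?_)
  simp only [toReal_gaussianPDF, gaussianPDFReal, NNReal.coe_one, sub_zero]
  rw [mul_comm (√(2 * Real.pi * 1))⁻¹, ← mul_assoc, ← Real.exp_add]
  congr 2
  ring

/-- Chernoff's bound for the central chi-square distribution. -/
theorem exists_noncentralChiSq_zero_tail_le (ν : ℕ) {l : ℝ} (hl0 : 0 ≤ l) (hl : l < 1 / 2) :
    ∃ C : ℝ, 0 < C ∧ ∀ x,
      (noncentralChiSq ν 0).real (Set.Ioi x) ≤ C * Real.exp (-(l * x)) := by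
  have hint : Integrable (fun y => Real.exp (l * y)) (noncentralChiSq ν 0) := by
    rw [noncentralChiSq, integrable_map_measure (by fun_prop) (measurable_sum_sq ν).aemeasurable]
    have : ((fun y => Real.exp (l * y)) ∘ fun z : Fin ν → ℝ => ∑ i, z i ^ 2) =
        fun z => ∏ i, Real.exp (l * z i ^ 2) := by
      ext z
      simp [← Real.exp_sum, Finset.mul_sum]
    rw [this]
    refine Integrable.fintype_prod_dep (f := fun _ z => Real.exp (l * z ^ 2)) fun i => ?_
    simpa using integrable_exp_mul_sq_gaussianReal hl
  refine ⟨mgf id (noncentralChiSq ν 0) l, mgf_pos hint, fun x => ?_⟩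
  have h := measure_ge_le_exp_mul_mgf (X := id) (μ := noncentralChiSq ν 0) x hl0 hint
  rw [mul_comm, ← neg_mul]
  have hsub : Set.Ioi x ⊆ {y | x ≤ id y} := fun y hy => (Set.mem_Ioi.1 hy).le
  exact (measureReal_mono hsub).trans h

/-- On `(a, a + 1]` the density is at least its value at `a + 1`. This crude bound costs only
factors below any power of `n`. -/
theorem gaussianReal_tail_ge {m a : ℝ} (h : m ≤ a) :
    (√(2 * Real.pi))⁻¹ * Real.exp (-((a + 1 - m) ^ 2 / 2)) ≤
      (gaussianReal m 1).real (Set.Ioi a) := by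
  have hsub : (gaussianReal m 1).real (Set.Ioc a (a + 1)) ≤ (gaussianReal m 1).real (Set.Ioi a) :=
    measureReal_mono Set.Ioc_subset_Ioi_self
  refine le_trans ?_ hsub
  rw [measureReal_def, gaussianReal_apply_eq_integral _ one_ne_zero,
    ENNReal.toReal_ofReal (integral_nonneg fun x => gaussianPDFReal_nonneg _ _ _)]
  have hc : (√(2 * Real.pi))⁻¹ * Real.exp (-((a + 1 - m) ^ 2 / 2)) =
      ∫ _x in Set.Ioc a (a + 1), (√(2 * Real.pi))⁻¹ * Real.exp (-((a + 1 - m) ^ 2 / 2)) := by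
    simp
  rw [hc]
  refine setIntegral_mono_on (integrableOn_const (by simp)) (integrable_gaussianPDFReal m 1).integrableOn
    measurableSet_Ioc fun x hx => ?_
  simp only [gaussianPDFReal, NNReal.coe_one, mul_one]
  gcongr
  rw [neg_div, neg_le_neg_iff]
  gcongr
  · linarith [hx.1]
  · exact hx.2

/-- The noncentral chi-square tail dominates the tail of its shifted coordinate. -/
theorem noncentralChiSq_tail_ge {ν : ℕ} (hν : 1 ≤ ν) {δ x : ℝ} :
    (gaussianReal √δ 1).real (Set.Ioi √x) ≤ (noncentralChiSq ν δ).real (Set.Ioi x) := by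
  let i₀ : Fin ν := ⟨0, hν⟩
  have hmp := measurePreserving_eval
    (fun i : Fin ν => gaussianReal (if i.val = 0 then √δ else 0) 1) i₀
  have h0 : gaussianReal √δ 1 = gaussianReal (if i₀.val = 0 then √δ else 0) 1 := by simp [i₀]
  rw [h0, ← hmp.map_eq, noncentralChiSq,
    map_measureReal_apply (measurable_pi_apply _) measurableSet_Ioi,
    map_measureReal_apply (by fun_prop) measurableSet_Ioi]
  refine measureReal_mono fun z hz => ?_
  have hz' : √x < z i₀ := hz
  have h1 : x < z i₀ ^ 2 := (Real.sqrt_lt' ((Real.sqrt_nonneg x).trans_lt hz')).1 hz'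
  exact h1.trans_le (Finset.single_le_sum (f := fun i => z i ^ 2) (fun i _ => sq_nonneg _)
    (Finset.mem_univ i₀))

/-! ### The weight and one-point evaluation -/

theorem weight_pos {u : ℝ} (hu : u ∈ Set.Ioo (0 : ℝ) 1) : 0 < weight u := by
  have h0 : 0 < u * (1 - u) := mul_pos hu.1 (by linarith [hu.2])
  have h4 : 4 ≤ 1 / (u * (1 - u)) := by
    rw [le_div_iff₀ h0]
    nlinarith [sq_nonneg (2 * u - 1)]
  have h1 : 1 < Real.log (1 / (u * (1 - u))) := by
    rw [Real.lt_log_iff_exp_lt (by linarith)]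
    linarith [Real.exp_one_lt_d9]
  exact Real.sqrt_pos.2 (mul_pos h0 (Real.log_pos h1))

/-- From `log log y ≤ log y ≤ y^η / η`: the iterated logarithm costs an arbitrarily small power. -/
theorem weight_sq_le {u η : ℝ} (hu0 : 0 ≤ u) (hu1 : u ≤ 1) (hη : 0 < η) (hη1 : η ≤ 1) :
    weight u ^ 2 ≤ u ^ (1 - η) / η := by
  by_cases hu' : u = 0 ∨ u = 1
  · have h : weight u = 0 := by rcases hu' with rfl | rfl <;> simp [weight]
    rw [h, sq, zero_mul]
    exact div_nonneg (Real.rpow_nonneg hu0 _) hη.le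
  push Not at hu'
  have hu : u ∈ Set.Ioo (0 : ℝ) 1 := ⟨lt_of_le_of_ne hu0 hu'.1.symm, lt_of_le_of_ne hu1 hu'.2⟩
  have h0 : 0 < u * (1 - u) := mul_pos hu.1 (by linarith [hu.2])
  have hle : u * (1 - u) ≤ u := by nlinarith [hu.1]
  have hw := weight_pos hu
  have hlog : Real.log (1 / (u * (1 - u))) ≤ (1 / (u * (1 - u))) ^ η / η :=
    Real.log_le_rpow_div (by positivity) hη
  have hlog0 : 0 ≤ Real.log (1 / (u * (1 - u))) := by
    refine Real.log_nonneg ?_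
    rw [le_div_iff₀ h0]
    nlinarith [hu.1, hu.2]
  rw [weight, Real.sq_sqrt (Real.sqrt_pos.1 hw).le]
  calc u * (1 - u) * Real.log (Real.log (1 / (u * (1 - u))))
      ≤ u * (1 - u) * ((1 / (u * (1 - u))) ^ η / η) := by
        gcongr
        exact (Real.log_le_self hlog0).trans hlog
    _ = (u * (1 - u)) ^ (1 - η) / η := by
        rw [Real.rpow_sub h0, Real.rpow_one, Real.div_rpow zero_le_one h0.le, Real.one_rpow]
        ring
    _ ≤ u ^ (1 - η) / η := by gcongr

/-- Evaluating the supremum at `P(χ²_ν(0) > x)` bounds the statistic below by a standardized count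
of exceedances of `x`. -/
theorem le_testStat {ν n : ℕ} {x : ℝ}
    (hu : (noncentralChiSq ν 0).real (Set.Ioi x) ∈ Set.Ioo (0 : ℝ) 1) (y : Fin n → ℝ) {t : ℝ}
    (h : n * (noncentralChiSq ν 0).real (Set.Ioi x) +
        t * √n * weight ((noncentralChiSq ν 0).real (Set.Ioi x)) ≤
      ∑ i, (Set.Ioi x).indicator (1 : ℝ → ℝ) (y i)) (hn : 0 < n) :
    (t : EReal) ≤ testStat ν y := by
  set u := (noncentralChiSq ν 0).real (Set.Ioi x) with hudef
  have hcdf : chiSqPValue ν x = u := by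
    rw [chiSqPValue, cdf_eq_real, ← probReal_compl_eq_one_sub measurableSet_Iic, Set.compl_Iic]
  refine le_trans ?_ (le_iSup (fun u : Set.Ioo (0 : ℝ) 1 =>
    ((√n * (edf (fun i => chiSqPValue ν (y i)) u - u) / weight u : ℝ) : EReal)) ⟨u, hu⟩)
  rw [EReal.coe_le_coe_iff, le_div_iff₀ (weight_pos hu)]
  have hsum : ∑ i, (Set.Ioi x).indicator (1 : ℝ → ℝ) (y i) ≤
      ∑ i, if chiSqPValue ν (y i) ≤ u then (1 : ℝ) else 0 := by
    refine Finset.sum_le_sum fun i _ => ?_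
    by_cases hi : y i ∈ Set.Ioi x
    · have : chiSqPValue ν (y i) ≤ u := by
        rw [← hcdf]
        exact sub_le_sub_left (monotone_cdf _ (le_of_lt hi)) 1
      simp [hi, this]
    · rw [Set.indicator_of_notMem hi]
      positivity
  have hn' : (0 : ℝ) < n := Nat.cast_pos.2 hn
  have hs : 0 < √(n : ℝ) := Real.sqrt_pos.2 hn'
  have hss : √(n : ℝ) * √n = n := Real.mul_self_sqrt hn'.le
  rw [edf, ← mul_le_mul_iff_right₀ hs]
  have : √(n : ℝ) * (√n * ((∑ i, if chiSqPValue ν (y i) ≤ u then (1 : ℝ) else 0) / n - u)) =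
      (∑ i, if chiSqPValue ν (y i) ≤ u then (1 : ℝ) else 0) - n * u := by
    rw [← mul_assoc, hss]
    field_simp
  rw [this]
  linarith

/-! ### Exponents at the threshold `2 s log n` -/

/-- Above the detection boundary some threshold exponent `s` separates the two components. -/
theorem exists_threshold_exponent {β r : ℝ} (hβ : β ∈ Set.Ioo (1 / 2 : ℝ) 1)
    (hr : r ∈ Set.Ioo (0 : ℝ) 1) (h : detectionBoundary β < r) :
    ∃ s, r < s ∧ s ≤ 1 ∧ 0 < 1 - 2 * β - 2 * (√s - √r) ^ 2 + s ∧
      0 < 1 - β - (√s - √r) ^ 2 := by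
  obtain ⟨hβ0, hβ1⟩ := hβ
  obtain ⟨hr0, hr1⟩ := hr
  have hsr : √r ^ 2 = r := Real.sq_sqrt hr0.le
  have hρ0 : 0 < √r := Real.sqrt_pos.2 hr0
  have hsβ : √(1 - β) ^ 2 = 1 - β := Real.sq_sqrt (by linarith)
  have hb0 : 0 < √(1 - β) := Real.sqrt_pos.2 (by linarith)
  rcases lt_or_ge r (1 / 4) with h4 | h4
  · have hβ4 : β < 3 / 4 := by
      by_contra hcon
      rw [detectionBoundary, if_neg hcon] at h
      have : √(1 - β) ≤ 1 / 2 := by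
        rw [Real.sqrt_le_left (by norm_num)]
        linarith
      nlinarith
    rw [detectionBoundary, if_pos hβ4] at h
    have h2 : √(4 * r) = 2 * √r := by
      rw [Real.sqrt_mul (by norm_num), show (4 : ℝ) = 2 ^ 2 by norm_num,
        Real.sqrt_sq (by norm_num)]
    -- `s = 4r` maximizes `s - 2(√s - √r)²`; there `w = r`, and the first condition becomes `r > β -
    -- 1/2`.
    refine ⟨4 * r, by linarith, by linarith, ?_, ?_⟩ <;> rw [h2] <;> nlinarith
  · have hr2 : 1 / 2 ≤ √r := Real.le_sqrt_of_sq_le (by linarith)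
    have hr1' : √r < 1 := by
      rw [Real.sqrt_lt' one_pos]
      linarith
    have key : 1 - √r < √(1 - β) := by
      by_cases hβ4 : β < 3 / 4
      · have : 1 / 2 < √(1 - β) := Real.lt_sqrt_of_sq_lt (by linarith)
        linarith
      · rw [detectionBoundary, if_neg hβ4] at h
        have := Real.lt_sqrt_of_sq_lt h
        linarith
    have key2 : (1 - √r) ^ 2 < 1 - β := by
      rw [← hsβ]
      gcongr
    -- At `s = 1` both conditions reduce to `(1 - √r)² < 1 - β`.
    refine ⟨1, hr1, le_rfl, ?_, ?_⟩ <;> rw [Real.sqrt_one] <;> linarith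

theorem exp_mul_log_natCast {n : ℕ} (hn : 1 ≤ n) (e : ℝ) :
    Real.exp (e * Real.log n) = (n : ℝ) ^ e := by
  rw [Real.rpow_def_of_pos (by exact_mod_cast hn), mul_comm]

/-- Chernoff with parameter `(s - η)/(2s) < 1/2`; `ν` affects only the constant. -/
theorem exists_null_tail_le (ν : ℕ) {s η : ℝ} (hs : 0 < s) (hη : 0 < η) (hηs : η ≤ s) :
    ∃ C : ℝ, 0 < C ∧ ∀ n : ℕ, 1 ≤ n →
      (noncentralChiSq ν 0).real (Set.Ioi (2 * s * Real.log n)) ≤ C * (n : ℝ) ^ (-s + η) := by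
  have hl0 : 0 ≤ (s - η) / (2 * s) := div_nonneg (by linarith) (by linarith)
  have hl : (s - η) / (2 * s) < 1 / 2 := by
    rw [div_lt_div_iff₀ (by linarith) (by norm_num)]
    linarith
  obtain ⟨C, hC, h⟩ := exists_noncentralChiSq_zero_tail_le ν hl0 hl
  refine ⟨C, hC, fun n hn => (h _).trans_eq ?_⟩
  rw [← exp_mul_log_natCast hn]
  have e : -((s - η) / (2 * s) * (2 * s * Real.log n)) = (-s + η) * Real.log n := by
    field_simp
    ring
  rw [e]

theorem exists_alternative_tail_ge {ν : ℕ} (hν : 1 ≤ ν) {r s η : ℝ} (hr : 0 ≤ r) (hrs : r ≤ s)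
    (hη : 0 < η) :
    ∃ c : ℝ, 0 < c ∧ ∀ n : ℕ, 1 ≤ n → c * (n : ℝ) ^ (-(√s - √r) ^ 2 - η) ≤
      (noncentralChiSq ν (2 * r * Real.log n)).real (Set.Ioi (2 * s * Real.log n)) := by
  set d := √s - √r with hd
  have hd0 : 0 ≤ d := sub_nonneg.2 (Real.sqrt_le_sqrt hrs)
  refine ⟨(√(2 * Real.pi))⁻¹ * Real.exp (-((1 + d ^ 2 / η) / 2)), by positivity,
    fun n hn => le_trans ?_ (noncentralChiSq_tail_ge hν)⟩
  have hL : 0 ≤ Real.log n := Real.log_natCast_nonneg n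
  have hl : √(2 * Real.log n) ^ 2 = 2 * Real.log n := Real.sq_sqrt (by linarith)
  have hsplit : ∀ y, 0 ≤ y → √(2 * y * Real.log n) = √y * √(2 * Real.log n) := fun y hy => by
    rw [← Real.sqrt_mul hy]
    congr 1
    ring
  rw [hsplit s (hr.trans hrs), hsplit r hr]
  refine le_trans ?_ (gaussianReal_tail_ge (by gcongr))
  rw [← exp_mul_log_natCast hn, mul_assoc, ← Real.exp_add]
  gcongr
  -- The cross term of the Gaussian exponent is of order `√(log n)`; AM-GM absorbs it into `η log n`
  -- plus a constant.
  have hamgm : 2 * (d * √(2 * Real.log n)) ≤ η * (2 * Real.log n) + d ^ 2 / η := by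
    have : 0 ≤ (η * √(2 * Real.log n) - d) ^ 2 / η := by positivity
    have e : (η * √(2 * Real.log n) - d) ^ 2 / η =
        η * √(2 * Real.log n) ^ 2 + d ^ 2 / η - 2 * (d * √(2 * Real.log n)) := by
      field_simp
      ring
    rw [e, hl] at this
    linarith
  have hsq : (√s * √(2 * Real.log n) + 1 - √r * √(2 * Real.log n)) ^ 2 =
      d ^ 2 * (2 * Real.log n) + 2 * (d * √(2 * Real.log n)) + 1 := by
    rw [hd]
    linear_combination (√s - √r) ^ 2 * hl
  rw [hsq]
  linarith

theorem chiSqMixture_real {ν : ℕ} {β r : ℝ} (hβ : 0 ≤ β) {n : ℕ} (hn : 1 ≤ n) (A : Set ℝ) :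
    (chiSqMixture ν β r n).real A =
      (1 - (n : ℝ) ^ (-β)) * (noncentralChiSq ν 0).real A +
        (n : ℝ) ^ (-β) * (noncentralChiSq ν (2 * r * Real.log n)).real A := by
  have h1 : (n : ℝ) ^ (-β) ≤ 1 :=
    Real.rpow_le_one_of_one_le_of_nonpos (by exact_mod_cast hn) (by linarith)
  have h0 : (0 : ℝ) ≤ (n : ℝ) ^ (-β) := by positivity
  rw [chiSqMixture, measureReal_add_apply
      (ENNReal.mul_ne_top ENNReal.ofReal_ne_top (measure_ne_top _ _))
      (ENNReal.mul_ne_top ENNReal.ofReal_ne_top (measure_ne_top _ _)),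
    measureReal_ennreal_smul_apply, measureReal_ennreal_smul_apply,
    ENNReal.toReal_ofReal (by linarith), ENNReal.toReal_ofReal h0]

theorem tendsto_div_zero_of_rpow_bounds {a b : ℕ → ℝ} {C c e f : ℝ} (hc : 0 < c)
    (ha0 : ∀ n, 0 ≤ a n) (ha : ∀ n : ℕ, 1 ≤ n → a n ≤ C * (n : ℝ) ^ e)
    (hb : ∀ n : ℕ, 1 ≤ n → c * (n : ℝ) ^ f ≤ b n) (hef : e < f) :
    Tendsto (fun n => a n / b n) atTop (𝓝 0) := by
  have hlim : Tendsto (fun n : ℕ => C / c * (n : ℝ) ^ (-(f - e))) atTop (𝓝 0) := by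
    simpa using ((tendsto_rpow_neg_atTop (sub_pos.2 hef)).comp
      tendsto_natCast_atTop_atTop).const_mul (C / c)
  refine squeeze_zero' ?_ ?_ hlim <;> filter_upwards [eventually_ge_atTop 1] with n hn
  · have hn' : (0 : ℝ) < n := by exact_mod_cast hn
    exact div_nonneg (ha0 n) (le_trans (by positivity) (hb n hn))
  · have hn' : (0 : ℝ) < n := by exact_mod_cast hn
    calc a n / b n ≤ C * (n : ℝ) ^ e / (c * (n : ℝ) ^ f) :=
          div_le_div₀ ((ha0 n).trans (ha n hn)) (ha n hn) (by positivity) (hb n hn)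
      _ = C / c * (n : ℝ) ^ (-(f - e)) := by
          rw [neg_sub, Real.rpow_sub hn']
          field_simp

/-! ### Miss probability and its limit -/

/-- Chebyshev's bound for the miss probability of the statistic evaluated at one threshold, when
the signal `n ε v` dominates the centring, the weight and the critical value. -/
theorem measureReal_testStat_lt_le {ν n : ℕ} (hn : 1 ≤ n) {β r : ℝ} (hβ : 0 ≤ β)
    {Ω : Type*} [MeasurableSpace Ω] {P : Measure Ω} [IsProbabilityMeasure P]
    {X : Fin n → Ω → ℝ} (hindep : iIndepFun X P) (hlaw : ∀ i, HasLaw (X i) (chiSqMixture ν β r n) P)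
    {x t u v ε : ℝ} (hudef : u = (noncentralChiSq ν 0).real (Set.Ioi x))
    (hvdef : v = (noncentralChiSq ν (2 * r * Real.log n)).real (Set.Ioi x))
    (hεdef : ε = (n : ℝ) ^ (-β)) (hu : u ∈ Set.Ioo (0 : ℝ) 1) (hv : 0 < v) (huv : u ≤ v / 2)
    (ht : t * √n * weight u ≤ n * ε * v / 4) :
    P.real {ω | ¬ (t : EReal) ≤ testStat ν fun i => X i ω} ≤
      16 * (u / (n * ε ^ 2 * v ^ 2) + 1 / (n * ε * v)) := by
  have hn' : (0 : ℝ) < n := by exact_mod_cast hn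
  have hε : 0 < ε := by rw [hεdef]; positivity
  have hp : (chiSqMixture ν β r n).real (Set.Ioi x) = (1 - ε) * u + ε * v := by
    rw [chiSqMixture_real hβ hn, hudef, hvdef, hεdef]
  have hd : 0 < n * ε * v / 4 := by positivity
  have hcount := measureReal_count_le hindep hlaw (measurableSet_Ioi (a := x)) hd
  rw [hp] at hcount
  refine (measureReal_mono fun ω hω => ?_).trans (hcount.trans ?_)
  · by_contra hcon
    refine hω (le_testStat (x := x) (hudef ▸ hu) _ ?_ hn)
    simp only [Set.mem_ofPred_eq, not_le] at hcon
    rw [← hudef]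
    -- The deviation `n ε v / 4` and the centring loss, at most `n ε v / 2`, leave `n ε v / 4` for
    -- the critical value.
    have : n * ε * u ≤ n * ε * (v / 2) := by gcongr
    linarith
  · have e : 16 * (u / (n * ε ^ 2 * v ^ 2) + 1 / (n * ε * v)) =
        n * (u + ε * v) / (n * ε * v / 4) ^ 2 := by
      field_simp
      ring
    rw [e]
    gcongr
    nlinarith [hu.1]

/-- One-point evaluation of the statistic already gives full power above the detection boundary, at
any fixed critical value. -/
theorem tendsto_measure_le_testStat {ν : ℕ} (hν : 1 ≤ ν) {β : ℝ} (hβ : β ∈ Set.Ioo (1 / 2 : ℝ) 1)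
    {r : ℝ} (hr : r ∈ Set.Ioo (0 : ℝ) 1) (hrβ : detectionBoundary β < r) (t : ℝ)
    {Ω : ℕ → Type*} [∀ n, MeasurableSpace (Ω n)]
    (P : ∀ n, Measure (Ω n)) [∀ n, IsProbabilityMeasure (P n)] (X : ∀ n, Fin n → Ω n → ℝ)
    (hindep : ∀ n, iIndepFun (X n) (P n)) (hlaw : ∀ n i, HasLaw (X n i) (chiSqMixture ν β r n) (P n)) :
    Tendsto (fun n => P n {ω | (t : EReal) ≤ testStat ν fun i => X n i ω}) atTop (𝓝 1) := by
  obtain ⟨s, hrs, hs1, hA, hB'⟩ := exists_threshold_exponent hβ hr hrβ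
  have hr0 := hr.1
  have hs0 : 0 < s := hr0.trans hrs
  have hws : (√s - √r) ^ 2 < s := by
    have h1 : √s ^ 2 = s := Real.sq_sqrt hs0.le
    have h2 : 0 < √r := Real.sqrt_pos.2 hr0
    have h3 : √r < √s := Real.sqrt_lt_sqrt hr0.le hrs
    nlinarith
  set w := (√s - √r) ^ 2 with hw
  -- The four bounds on `η` serve, in order, `hR3` (and `hR1`), `hR2`, `hR4` and the Chernoff
  -- parameter.
  obtain ⟨η, hη0, hη⟩ : ∃ η : ℝ, 0 < η ∧ η < min (min ((1 - 2 * β - 2 * w + s) / 4) (1 - β - w))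
      (min ((s - w) / 2) s) := exists_between (by
    refine lt_min (lt_min ?_ ?_) (lt_min ?_ ?_) <;> linarith)
  simp only [lt_min_iff] at hη
  obtain ⟨⟨hη1, hη2⟩, hη3, hη4⟩ := hη
  obtain ⟨C, hC, hu⟩ := exists_null_tail_le ν hs0 hη0 hη4.le
  obtain ⟨c, hc, hv⟩ := exists_alternative_tail_ge hν hr0.le hrs.le hη0
  rw [neg_eq_neg_one_mul, ← hw, ← neg_eq_neg_one_mul] at hv
  set u : ℕ → ℝ := fun n => (noncentralChiSq ν 0).real (Set.Ioi (2 * s * Real.log n)) with hudef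
  set v : ℕ → ℝ := fun n =>
    (noncentralChiSq ν (2 * r * Real.log n)).real (Set.Ioi (2 * s * Real.log n)) with hvdef
  have hu0 : ∀ n, 0 ≤ u n := fun n => measureReal_nonneg
  have hq : ∀ n : ℕ, 1 ≤ n → weight (u n) ^ 2 ≤ C ^ (1 - η) / η * (n : ℝ) ^ (-s + 2 * η) := by
    intro n hn
    have hn1 : (1 : ℝ) ≤ n := by exact_mod_cast hn
    calc weight (u n) ^ 2 ≤ u n ^ (1 - η) / η :=
          weight_sq_le (hu0 n) measureReal_le_one hη0 (by linarith)
      _ ≤ (C * (n : ℝ) ^ (-s + η)) ^ (1 - η) / η := by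
          gcongr
          · linarith
          · exact hu n hn
      _ = C ^ (1 - η) / η * (n : ℝ) ^ ((-s + η) * (1 - η)) := by
          rw [Real.mul_rpow hC.le (by positivity), ← Real.rpow_mul (by positivity)]
          ring
      _ ≤ _ := by
          gcongr
          -- Uses `s ≤ 1`: `(-s + η)(1 - η) = -s + (1 + s)η - η²`.
          nlinarith
  have hb1 : ∀ n : ℕ, 1 ≤ n →
      c * (n : ℝ) ^ (1 - β - w - η) ≤ n * (n : ℝ) ^ (-β) * v n := by
    intro n hn
    have hn' : (0 : ℝ) < n := by exact_mod_cast hn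
    calc c * (n : ℝ) ^ (1 - β - w - η)
        = (n : ℝ) ^ (1 : ℝ) * (n : ℝ) ^ (-β) * (c * (n : ℝ) ^ (-w - η)) := by
          rw [mul_left_comm, ← Real.rpow_add hn', ← Real.rpow_add hn']
          ring_nf
      _ ≤ _ := by
          rw [Real.rpow_one]
          gcongr
          exact hv n hn
  have hb2 : ∀ n : ℕ, 1 ≤ n →
      c ^ 2 * (n : ℝ) ^ (1 - 2 * β - 2 * w - 2 * η) ≤
        n * ((n : ℝ) ^ (-β)) ^ 2 * v n ^ 2 := by
    intro n hn
    have hn' : (0 : ℝ) < n := by exact_mod_cast hn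
    calc c ^ 2 * (n : ℝ) ^ (1 - 2 * β - 2 * w - 2 * η)
        = (c * (n : ℝ) ^ (1 - β - w - η)) ^ 2 / n := by
          rw [mul_pow, ← Real.rpow_mul_natCast hn'.le, mul_div_assoc, ← Real.rpow_sub_one hn'.ne']
          push_cast
          ring_nf
      _ ≤ (n * (n : ℝ) ^ (-β) * v n) ^ 2 / n := by
          have := pow_le_pow_left₀ (by positivity) (hb1 n hn) 2
          gcongr
      _ = _ := by
          field_simp
  have hR1 : Tendsto (fun n : ℕ => u n / (n * ((n : ℝ) ^ (-β)) ^ 2 * v n ^ 2)) atTop (𝓝 0) :=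
    tendsto_div_zero_of_rpow_bounds (sq_pos_of_pos hc) hu0 hu hb2 (by linarith)
  have hR2 : Tendsto (fun n : ℕ => 1 / (n * (n : ℝ) ^ (-β) * v n)) atTop (𝓝 0) :=
    tendsto_div_zero_of_rpow_bounds (a := fun _ => 1) (C := 1) (e := 0) hc (fun _ => zero_le_one)
      (fun n _ => by simp) hb1 (by linarith)
  have hR3 : Tendsto (fun n : ℕ => weight (u n) ^ 2 / (n * ((n : ℝ) ^ (-β)) ^ 2 * v n ^ 2))
      atTop (𝓝 0) :=
    tendsto_div_zero_of_rpow_bounds (sq_pos_of_pos hc) (fun n => sq_nonneg _) hq hb2 (by linarith)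
  have hR4 : Tendsto (fun n : ℕ => u n / v n) atTop (𝓝 0) :=
    tendsto_div_zero_of_rpow_bounds hc hu0 hu hv (by linarith)
  have hmiss : Tendsto (fun n => (P n).real {ω | ¬ (t : EReal) ≤ testStat ν fun i => X n i ω})
      atTop (𝓝 0) := by
    have hlim := (hR1.add hR2).const_mul 16
    rw [add_zero, mul_zero] at hlim
    refine squeeze_zero' (Eventually.of_forall fun n => measureReal_nonneg) ?_ hlim
    filter_upwards [eventually_ge_atTop 1, hR4.eventually_le_const (show (0 : ℝ) < 1 / 2 by norm_num),
      (hR3.const_mul (16 * t ^ 2)).eventually_le_const (show 16 * t ^ 2 * 0 < 1 by simp)]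
      with n hn h4 h3
    have hn' : (0 : ℝ) < n := by exact_mod_cast hn
    have hvpos : 0 < v n := lt_of_lt_of_le (by positivity) (hv n hn)
    have huv : u n ≤ v n / 2 := by
      rw [div_le_iff₀ hvpos] at h4
      linarith
    have hv1 : v n ≤ 1 := measureReal_le_one
    have hupos : 0 < u n :=
      lt_of_lt_of_le (lt_of_lt_of_le (by positivity)
        (gaussianReal_tail_ge (Real.sqrt_le_sqrt (by positivity)))) (noncentralChiSq_tail_ge hν)
    refine measureReal_testStat_lt_le hn (by linarith [hβ.1]) (hindep n) (hlaw n) rfl rfl rfl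
      ⟨hupos, by linarith⟩ hvpos huv ?_
    -- Comparing squares lets `hR3` apply whatever the sign of `t`.
    refine (abs_le_of_sq_le_sq' ?_ (by positivity)).2
    rw [← mul_div_assoc, div_le_one (by positivity)] at h3
    rw [mul_pow, mul_pow, Real.sq_sqrt hn'.le]
    have : n * (16 * t ^ 2 * weight (u n) ^ 2) ≤ n * (n * ((n : ℝ) ^ (-β)) ^ 2 * v n ^ 2) := by
      gcongr
    linarith
  have hlow : Tendsto (fun n => 1 - P n {ω | ¬ (t : EReal) ≤ testStat ν fun i => X n i ω})
      atTop (𝓝 1) := by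
    have := ENNReal.tendsto_ofReal hmiss
    simp only [ENNReal.ofReal_zero] at this
    simpa using ENNReal.Tendsto.sub tendsto_const_nhds this (Or.inl ENNReal.one_ne_top)
  refine tendsto_of_tendsto_of_tendsto_of_le_of_le hlow tendsto_const_nhds (fun n => ?_)
    fun n => prob_le_one
  rw [tsub_le_iff_right]
  calc (1 : ENNReal) = P n Set.univ := measure_univ.symm
    _ ≤ P n ({ω | (t : EReal) ≤ testStat ν fun i => X n i ω} ∪
          {ω | ¬ (t : EReal) ≤ testStat ν fun i => X n i ω}) :=
        measure_mono fun ω _ => em _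
    _ ≤ _ := measure_union_le _ _

end SparseMixture

theorem theorem4p2
    -- degrees of freedom, sparsity index, signal strength
    (ν : ℕ) (hν : 1 ≤ ν)
    (β : ℝ) (hβ : β ∈ Set.Ioo (1 / 2 : ℝ) 1)
    (r : ℝ) (hr : r ∈ Set.Ioo (0 : ℝ) 1)
    (hrβ : SparseMixture.detectionBoundary β < r)
    -- level, Brownian bridge and critical value
    (α : ℝ) (hα : α ∈ Set.Ioo (0 : ℝ) 1)
    {Ω₀ : Type*} [MeasurableSpace Ω₀] (P₀ : Measure Ω₀) [IsProbabilityMeasure P₀]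
    (B : Set.Icc (0 : ℝ) 1 → Ω₀ → ℝ) (hB : SparseMixture.IsBrownianBridge B P₀)
    (t : ℝ) (ht : SparseMixture.IsCriticalValue B P₀ α t)
    -- for each `n`, an iid sample of size `n` from the mixture
    {Ω : ℕ → Type*} [∀ n, MeasurableSpace (Ω n)]
    (P : ∀ n, Measure (Ω n)) [∀ n, IsProbabilityMeasure (P n)]
    (X : ∀ n, Fin n → Ω n → ℝ)
    (hindep : ∀ n, iIndepFun (X n) (P n))
    (hlaw : ∀ n i, HasLaw (X n i) (SparseMixture.chiSqMixture ν β r n) (P n)) :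
    Tendsto
      (fun n => P n {ω | (t : EReal) ≤ SparseMixture.testStat ν fun i => X n i ω})
      atTop (𝓝 1) := by
  exact SparseMixture.tendsto_measure_le_testStat hν hβ hr hrβ t P X hindep hlaw
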